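/- \textbf{Setting.} Let $L \ge 0$ be an integer, $E = \{1, \dots, L\}$, and let $f : 2^E \to [0, \infty)$ satisfy $f(\emptyset) = 0$, be monotone ($f(X) \le f(Y)$ if $X \subseteq Y$) and submodular ($f(X) + f(Y) \ge f(X \cup Y) + f(X \cap Y)$), with $f(\{e\}) \le 1$ for all $e \in E$; thus $M = (E, f)$ is a polymatroid. For a weight vector $w \in \mathbb{R}^L$, $\mathrm{Greedy}(M, w)$ sorts the items so that $w(e_1) \ge \dots \ge w(e_L)$, ties being broken by an arbitrary but fixed (measurable) rule, and returns the vector $x$ with $x(e_i) = f(\{e_1, \dots, e_i\}) - f(\{e_1, \dots, e_{i-1}\})$. Let $\Theta = \{\mathrm{Greedy}(M, w) : w \in [0, \infty)^L\}$ be the set of feasible solutions. Let $P$ be a probability distribution on $[0, 1]^L$ with mean $\bar w$, where the items are numbered so that $\bar w(1) \ge \dots \ge \bar w(L)$, and let $w_0, w_1, w_2, \dots$ be i.i.d. with distribution $P$ (the weights of different items in one $w_t$ may be dependent). Let $x^* \in \Theta$ be an optimal solution, $\langle \bar w, x^* \rangle = \max_{x \in \Theta} \langle \bar w, x \rangle$.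 \textbf{Algorithm OPM.} Put $c_{t, s} = \sqrt{2 \log t / s}$ for $t \ge 1$ and $c_{0, s} = 0$. Initially all of $w_0$ is observed, $T_0(e) = 1$, and the estimate of the weight of $e$ is $w_0(e)$. In episode $t = 1, 2, \dots$, OPM computes for each item $e$ the index $U_t(e) = \hat w_{T_{t-1}(e)}(e) + c_{t-1, T_{t-1}(e)}$, where $T_{t-1}(e)$ is the number of observations of the weight of $e$ so far (including the initial one) and $\hat w_{T_{t-1}(e)}(e)$ is the average of these observations; it chooses $x_t = \mathrm{Greedy}(M, U_t)$ and observes $w_t(e)$ exactly for those $e$ with $x_t(e) > 0$. Its expected cumulative regret over $n$ episodes is $$R(n) = \mathbb{E}\Big[\sum_{t=1}^n \big(\langle w_t, x^* \rangle - \langle w_t, x_t \rangle\big)\Big].$$ \textbf{Gaps.} For items $e, e^*$ let $\Delta_{e, e^*} = \bar w(e^*) - \bar w(e)$. For an item $e$ let $\rho(e)$ be the largest index $i$ with $\bar w(i) > \bar w(e)$ and $x^*(i) > 0$, and $\rho(e) = 0$ if there is no such $i$. \textbf{Theorem (gap-dependent bound).} For every $n \ge 1$ the cumulative regret is integrable and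 $$R(n) \le B(n) := \sum_{e :\, \rho(e) \ne 0} \frac{16}{\Delta_{e, \rho(e)}} \log n + \sum_{e = 1}^L \sum_{e^* = 1}^{\rho(e)} \Delta_{e, e^*} \, \frac{4}{3} \pi^2 .$$ Moreover, if $\rho(e) \neq 0$ for some $e$ and $\Delta = \min_e \min_{1 \le e^* \le \rho(e)} \Delta_{e, e^*}$, then $B(n) = O(L (1/\Delta) \log n)$ as $n \to \infty$ with an absolute constant: for every $C > 16$ we have $B(n) \le C \, L \, (1/\Delta) \log n$ for all sufficiently large $n$. -/

import Mathlib

open MeasureTheory ProbabilityTheory Filter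

namespace PolymatroidBandit

noncomputable section

/-- `(Fin L, f)` is a polymatroid: `f` is non-negative, vanishes at the empty set, is monotone and
submodular. It is normalized so that every single item has value at most one. -/
structure IsPolymatroid {L : ℕ} (f : Finset (Fin L) → ℝ) : Prop where
  nonneg : ∀ X, 0 ≤ f X
  empty : f ∅ = 0
  mono : ∀ X Y, X ⊆ Y → f X ≤ f Y
  submodular : ∀ X Y, f (X ∪ Y) + f (X ∩ Y) ≤ f X + f Y
  singleton_le_one : ∀ e, f {e} ≤ 1

/-- A fixed rule that sorts the items by decreasing weight, breaking ties in an arbitrary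
(measurable) way: `order w i` is the item in position `i` when the weights are `w`. -/
structure SortRule (L : ℕ) where
  order : (Fin L → ℝ) → Equiv.Perm (Fin L)
  antitone : ∀ w : Fin L → ℝ, Antitone fun i => w (order w i)
  measurableSet_order : ∀ σ : Equiv.Perm (Fin L), MeasurableSet {w | order w = σ}

/-- The vector built greedily along the ordering `σ`: each item receives the increase of `f` when
it is added to the set of the items that precede it. -/
def greedyAlong {L : ℕ} (f : Finset (Fin L) → ℝ) (σ : Equiv.Perm (Fin L)) (e : Fin L) : ℝ :=
  f (Finset.univ.filter fun i => σ.symm i ≤ σ.symm e) -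
    f (Finset.univ.filter fun i => σ.symm i < σ.symm e)

/-- The greedy algorithm for a maximum-weight basis. -/
def greedy {L : ℕ} (f : Finset (Fin L) → ℝ) (G : SortRule L) (w : Fin L → ℝ) : Fin L → ℝ :=
  greedyAlong f (G.order w)

/-- The feasible solutions: the outputs of the greedy algorithm on non-negative weights. -/
def feasible {L : ℕ} (f : Finset (Fin L) → ℝ) (G : SortRule L) : Set (Fin L → ℝ) :=
  {x | ∃ w : Fin L → ℝ, (∀ e, 0 ≤ w e) ∧ x = greedy f G w}

/-- The expected weights of the items under the weight distribution `P`. -/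
def meanWeight {L : ℕ} (P : Measure (Fin L → ℝ)) (e : Fin L) : ℝ :=
  ∫ v, v e ∂P

/-- `x` is a feasible solution of maximum expected weight, where `m` are the expected weights. -/
def IsOptimal {L : ℕ} (f : Finset (Fin L) → ℝ) (G : SortRule L) (m x : Fin L → ℝ) : Prop :=
  x ∈ feasible f G ∧ ∀ y ∈ feasible f G, m ⬝ᵥ y ≤ m ⬝ᵥ x

/-- The confidence radius `c_{t,s}`. Since `Real.log 0 = 0`, it is zero for `t = 0`. -/
def radius (t s : ℕ) : ℝ :=
  Real.sqrt (2 * Real.log t / s)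

/-- The statistics kept by the algorithm: for each item, the number of its observations and the
average of the observed weights. -/
structure Stats (L : ℕ) where
  count : Fin L → ℕ
  est : Fin L → ℝ

/-- The upper confidence bounds computed after `t` episodes, that is, those used in episode
`t + 1`. -/
def ucb {L : ℕ} (t : ℕ) (S : Stats L) (e : Fin L) : ℝ :=
  S.est e + radius t (S.count e)

/-- The update of the statistics after the basis `x` was chosen and the weights `v e` of the items
`e` with `0 < x e` were observed. -/
def Stats.update {L : ℕ} (S : Stats L) (x v : Fin L → ℝ) : Stats L where
  count e := if 0 < x e then S.count e + 1 else S.count e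
  est e := if 0 < x e then (S.count e * S.est e + v e) / (S.count e + 1 : ℕ) else S.est e

/-- The statistics of OPM after `t` episodes on the weight sequence `v`, where `v 0` is the
initial observation of all the items and `v (t + 1)` are the weights in episode `t + 1`. -/
def opmStats {L : ℕ} (f : Finset (Fin L) → ℝ) (G : SortRule L) (v : ℕ → Fin L → ℝ) : ℕ → Stats L
  | 0 => ⟨fun _ => 1, v 0⟩
  | t + 1 => (opmStats f G v t).update (greedy f G (ucb t (opmStats f G v t))) (v (t + 1))

/-- The basis chosen by OPM in episode `t + 1`. -/
def opmBasis {L : ℕ} (f : Finset (Fin L) → ℝ) (G : SortRule L) (v : ℕ → Fin L → ℝ) (t : ℕ) :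
    Fin L → ℝ :=
  greedy f G (ucb t (opmStats f G v t))

/-- The cumulative regret of OPM in the episodes `1, …, n`, relative to the solution `x`, on the
weight sequence `v`. -/
def opmRegret {L : ℕ} (f : Finset (Fin L) → ℝ) (G : SortRule L) (x : Fin L → ℝ)
    (v : ℕ → Fin L → ℝ) (n : ℕ) : ℝ :=
  ∑ t ∈ Finset.range n, (v (t + 1) ⬝ᵥ x - v (t + 1) ⬝ᵥ opmBasis f G v t)

/-- The gap `Δ_{e,i} = m i - m e` between the expected weights of the items `i` and `e`. -/
def gap {L : ℕ} (m : Fin L → ℝ) (e i : Fin L) : ℝ :=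
  m i - m e

/-- `ρ(e)`: the largest item with a larger expected weight than `e` that contributes to the
optimal solution `x`, and `⊥` if there is no such item. -/
def rho {L : ℕ} (m x : Fin L → ℝ) (e : Fin L) : WithBot (Fin L) :=
  (Finset.univ.filter fun i => m e < m i ∧ 0 < x i).max

/-- The value `∑ₑ 16 / Δ_{e,ρ(e)} * log n + ∑ₑ ∑_{i ≤ ρ(e)} Δ_{e,i} * (4 / 3) * π ^ 2`. The inner
sum in the first term has the single index `r = ρ(e)`, and is empty if `ρ(e) = ⊥`. -/
def regretBound {L : ℕ} (m x : Fin L → ℝ) (n : ℕ) : ℝ :=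
  (∑ e : Fin L, ∑ r ∈ Finset.univ.filter fun r : Fin L => rho m x e = (r : WithBot (Fin L)),
      16 / gap m e r * Real.log n) +
    ∑ e : Fin L, ∑ i ∈ Finset.univ.filter fun i : Fin L => (i : WithBot (Fin L)) ≤ rho m x e,
      gap m e i * (4 / 3 * Real.pi ^ 2)

end

end PolymatroidBandit

open PolymatroidBandit

/-!
The regret is charged to pairs of an item `e` and an item `i` of larger expected weight. In the
ordering used by the greedy algorithm, every initial set of items has at least as much mass in the
greedy solution as in any base, and the total masses agree. Hence the monotone coupling of the two
mass distributions transports mass of the greedy solution only from an item `e` to an item `i` that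
is ranked behind `e` (`exists_monotone_coupling`), and the loss of an episode is at most the sum of
`gap m e i * g e i` over the pairs with `i ≤ ρ(e)`, where `g` is the coupling
(`exists_loss_decomposition`). Of the solution `x` this uses only that it lies in the base polytope.

If `g e i` is positive, then the upper confidence bound of `e` was at least that of `i`. So either
one of the two estimates is off by at least its confidence radius, or `e` has been observed at most
`8 log n / gap m e i ^ 2` times (`ucb_lt_ucb`). In the second case, when `e` has been observed `s`
times, only gaps of size at most `√(8 log n / s)` contribute; since `g e` has total mass at most one
and `s` grows each time `e` receives mass, these losses sum to at most `16 log n / gap m e ρ(e)`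
(`sum_le_two_mul_sqrt_mul_sqrt`, `sum_loss_le`).

The failures are controlled by Hoeffding's inequality. As the observations are selected adaptively,
it is derived from the exponential supermartingale of the observed deviations
(`lintegral_expSupermart_le_one`), followed by a union bound over the number of observations. A
failure in the episode with index `t ≥ 1` has probability at most `2 (t + 1) / t ^ 4`, and the sum
of these probabilities, increased by one for the first episode, is less than `4 / 3 * π ^ 2`
(`sum_measureReal_failure_le`).
-/

namespace PolymatroidBandit

/-! ### The greedy solution and the base polytope -/

/-- `x` lies in the base polytope of `f`. -/
structure IsBase {L : ℕ} (f : Finset (Fin L) → ℝ) (x : Fin L → ℝ) : Prop where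
  nonneg : ∀ e, 0 ≤ x e
  sum_le : ∀ X, ∑ e ∈ X, x e ≤ f X
  sum_univ : ∑ e, x e = f Finset.univ

/-- The set of the first `k` items in the ordering `σ`. -/
def firstItems {L : ℕ} (σ : Equiv.Perm (Fin L)) (k : ℕ) : Finset (Fin L) :=
  Finset.univ.filter fun i => (σ.symm i : ℕ) < k

section
variable {L : ℕ} (σ : Equiv.Perm (Fin L))

lemma mem_firstItems {k : ℕ} {i : Fin L} : i ∈ firstItems σ k ↔ (σ.symm i : ℕ) < k := by
  simp [firstItems]

lemma firstItems_mono : Monotone (firstItems σ) := fun _ _ h _ hi =>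
  (mem_firstItems σ).2 (((mem_firstItems σ).1 hi).trans_le h)

lemma firstItems_zero : firstItems σ 0 = ∅ := by
  simp [firstItems]

lemma firstItems_eq_univ : firstItems σ L = Finset.univ := by
  ext i; simp [mem_firstItems]

lemma apply_notMem_firstItems (p : Fin L) : σ p ∉ firstItems σ p := by
  simp [mem_firstItems]

lemma firstItems_succ (p : Fin L) :
    firstItems σ (p + 1) = insert (σ p) (firstItems σ p) := by
  ext i
  rw [Finset.mem_insert, mem_firstItems, mem_firstItems, ← Equiv.symm_apply_eq, Fin.ext_iff]
  omega

lemma greedyAlong_apply (f : Finset (Fin L) → ℝ) (p : Fin L) :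
    greedyAlong f σ (σ p) = f (firstItems σ (p + 1)) - f (firstItems σ p) := by
  simp [greedyAlong, firstItems]

/-- Telescoping along an ordering. -/
lemma sum_firstItems_sub (h : Finset (Fin L) → ℝ) :
    ∑ p : Fin L, (h (firstItems σ (p + 1)) - h (firstItems σ p)) = h Finset.univ - h ∅ := by
  rw [Fin.sum_univ_eq_sum_range (fun k => h (firstItems σ (k + 1)) - h (firstItems σ k)),
    Finset.sum_range_sub (fun k => h (firstItems σ k)), firstItems_eq_univ, firstItems_zero]

end

lemma isBase_greedyAlong {L : ℕ} {f : Finset (Fin L) → ℝ} (hf : IsPolymatroid f)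
    (σ : Equiv.Perm (Fin L)) : IsBase f (greedyAlong f σ) where
  nonneg e := by
    rw [← σ.apply_symm_apply e, greedyAlong_apply]
    exact sub_nonneg.2 (hf.mono _ _ (firstItems_mono σ (Nat.le_succ _)))
  sum_le X := by
    classical
    calc ∑ e ∈ X, greedyAlong f σ e
        = ∑ p : Fin L, if σ p ∈ X then greedyAlong f σ (σ p) else 0 := by
          rw [Equiv.sum_comp σ (fun e => if e ∈ X then greedyAlong f σ e else 0)]
          simp
      _ ≤ ∑ p : Fin L, (f (firstItems σ (p + 1) ∩ X) - f (firstItems σ p ∩ X)) := by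
          refine Finset.sum_le_sum fun p _ => ?_
          split_ifs with hp
          · -- diminishing returns: `σ p` is worth more on top of the smaller set
            have h := hf.submodular (firstItems σ (p + 1) ∩ X) (firstItems σ p)
            have h1 : firstItems σ (p + 1) ∩ X ∪ firstItems σ p = firstItems σ (p + 1) := by
              rw [firstItems_succ]; ext i; simp only [Finset.mem_union, Finset.mem_inter,
                Finset.mem_insert]
              constructor
              · tauto
              · rintro (rfl | h) <;> tauto
            have h2 : firstItems σ (p + 1) ∩ X ∩ firstItems σ p = firstItems σ p ∩ X := by
              have := firstItems_mono σ (Nat.le_succ p)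
              ext i; simp only [Finset.mem_inter]
              exact ⟨fun h => ⟨h.2, h.1.2⟩, fun h => ⟨⟨this h.1, h.2⟩, h.1⟩⟩
            rw [h1, h2] at h
            rw [greedyAlong_apply]; linarith
          · rw [firstItems_succ, Finset.insert_inter_of_notMem hp, sub_self]
      _ = f X := by
          rw [sum_firstItems_sub σ (fun Y => f (Y ∩ X))]
          simp [hf.empty]
  sum_univ := by
    rw [← Equiv.sum_comp σ]
    simp_rw [greedyAlong_apply]
    rw [sum_firstItems_sub, hf.empty, sub_zero]

lemma IsBase.le_one {L : ℕ} {f : Finset (Fin L) → ℝ} (hf : IsPolymatroid f) {x : Fin L → ℝ}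
    (hx : IsBase f x) (e : Fin L) : x e ≤ 1 := by
  simpa using (hx.sum_le {e}).trans (hf.singleton_le_one e)

/-! ### Coupling the greedy solution with a base -/

/-- The length of the intersection of the intervals `[a, b]` and `[c, d]` is non-negative. -/
lemma min_sub_min_nonneg {a b c d : ℝ} (hab : a ≤ b) (hcd : c ≤ d) :
    0 ≤ min b d - min a d - min b c + min a c := by
  rcases le_total b d with h1 | h1 <;> rcases le_total a d with h2 | h2 <;>
  rcases le_total b c with h3 | h3 <;> rcases le_total a c with h4 | h4 <;>
  simp only [min_eq_left, min_eq_right, h1, h2, h3, h4] <;> linarith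

/-- A base is no more concentrated on the initial items of an ordering than the greedy solution
along it. Hence there is a transport plan from the greedy solution to the base that never moves mass
towards the beginning of the ordering. It is the monotone coupling: `g e i` is the length of the
intersection of the intervals that `e` and `i` occupy when the masses of the greedy solution and of
the base are laid out along a line in this ordering. -/
lemma exists_monotone_coupling {L : ℕ} {f : Finset (Fin L) → ℝ} (hf : IsPolymatroid f)
    {x : Fin L → ℝ} (hx : IsBase f x) (σ : Equiv.Perm (Fin L)) :
    ∃ g : Fin L → Fin L → ℝ, (∀ e i, 0 ≤ g e i) ∧ (∀ e, ∑ i, g e i = greedyAlong f σ e) ∧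
      (∀ i, ∑ e, g e i = x i) ∧ ∀ e i, g e i ≠ 0 → σ.symm e ≤ σ.symm i := by
  classical
  set A : ℕ → ℝ := fun k => f (firstItems σ k) with hA
  set B : ℕ → ℝ := fun k => ∑ i ∈ firstItems σ k, x i with hB
  have hAm : Monotone A := fun a b h => hf.mono _ _ (firstItems_mono σ h)
  have hBm : Monotone B := fun a b h =>
    Finset.sum_le_sum_of_subset_of_nonneg (firstItems_mono σ h) fun i _ _ => hx.nonneg i
  have hBA : ∀ k, B k ≤ A k := fun k => hx.sum_le _
  have hA0 : A 0 = 0 := by simp [hA, firstItems_zero, hf.empty]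
  have hB0 : B 0 = 0 := by simp [hB, firstItems_zero]
  have hABL : A L = B L := by simp [hA, hB, firstItems_eq_univ, hx.sum_univ]
  have hBs : ∀ p : Fin L, x (σ p) = B (p + 1) - B p := fun p => by
    simp only [hB]
    rw [firstItems_succ, Finset.sum_insert (apply_notMem_firstItems σ p)]; ring
  have hA_le : ∀ k ≤ L, A k ≤ B L := fun k hk => hABL ▸ hAm hk
  have hB_le : ∀ k ≤ L, B k ≤ A L := fun k hk => hABL ▸ hBm hk
  have hA_nn : ∀ k, 0 ≤ A k := fun k => hA0 ▸ hAm (Nat.zero_le k)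
  have hB_nn : ∀ k, 0 ≤ B k := fun k => hB0 ▸ hBm (Nat.zero_le k)
  let g : ℕ → ℕ → ℝ := fun j k =>
    min (A (j + 1)) (B (k + 1)) - min (A j) (B (k + 1)) - min (A (j + 1)) (B k) + min (A j) (B k)
  refine ⟨fun e i => g (σ.symm e) (σ.symm i), fun e i => ?_, fun e => ?_, fun i => ?_,
    fun e i => ?_⟩
  · exact min_sub_min_nonneg (hAm (Nat.le_succ _)) (hBm (Nat.le_succ _))
  · obtain ⟨p, rfl⟩ := σ.surjective e
    rw [greedyAlong_apply, ← Equiv.sum_comp σ]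
    simp only [Equiv.symm_apply_apply]
    rw [Fin.sum_univ_eq_sum_range (fun k => g p k)]
    calc ∑ k ∈ Finset.range L, g p k
        = ∑ k ∈ Finset.range L, ((min (A (p + 1)) (B (k + 1)) - min (A p) (B (k + 1))) -
            (min (A (p + 1)) (B k) - min (A p) (B k))) :=
          Finset.sum_congr rfl fun k _ => by simp only [g]; ring
      _ = A (p + 1) - A p := by
          rw [Finset.sum_range_sub (fun k => min (A (p + 1)) (B k) - min (A p) (B k))]
          simp only [hB0, min_eq_left (hA_le _ p.2), min_eq_left (hA_le _ p.2.le),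
            min_eq_right (hA_nn _)]
          ring
  · obtain ⟨p, rfl⟩ := σ.surjective i
    rw [hBs, ← Equiv.sum_comp σ]
    simp only [Equiv.symm_apply_apply]
    rw [Fin.sum_univ_eq_sum_range (fun k => g k p)]
    calc ∑ k ∈ Finset.range L, g k p
        = ∑ k ∈ Finset.range L, ((min (A (k + 1)) (B (p + 1)) - min (A (k + 1)) (B p)) -
            (min (A k) (B (p + 1)) - min (A k) (B p))) :=
          Finset.sum_congr rfl fun k _ => by simp only [g]; ring
      _ = B (p + 1) - B p := by
          rw [Finset.sum_range_sub (fun k => min (A k) (B (p + 1)) - min (A k) (B p))]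
          simp only [hA0, min_eq_right (hB_le _ p.2), min_eq_right (hB_le _ p.2.le),
            min_eq_left (hB_nn _)]
          ring
  · contrapose!
    intro h
    have h' : (σ.symm i : ℕ) + 1 ≤ σ.symm e := h
    -- the interval of `i` ends before the interval of `e` begins
    have h1 : B (σ.symm i + 1) ≤ A (σ.symm e) := (hBA _).trans (hAm h')
    have h2 : B (σ.symm i) ≤ A (σ.symm e) := (hBm (Nat.le_succ _)).trans h1
    have h3 : A (σ.symm e) ≤ A (σ.symm e + 1) := hAm (Nat.le_succ _)
    simp only [g, min_eq_right h1, min_eq_right h2, min_eq_right (h1.trans h3),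
      min_eq_right (h2.trans h3)]
    ring

/-- The loss of the greedy solution along `σ` relative to a base, charged to pairs of an item `e`
and an item `i ≤ ρ(e)` that is ranked behind `e` although its expected weight is larger. -/
lemma exists_loss_decomposition {L : ℕ} {f : Finset (Fin L) → ℝ} (hf : IsPolymatroid f)
    {x : Fin L → ℝ} (hx : IsBase f x) (m : Fin L → ℝ) (σ : Equiv.Perm (Fin L)) :
    ∃ g : Fin L → Fin L → ℝ, (∀ e i, 0 ≤ g e i) ∧ (∀ e, ∑ i, g e i = greedyAlong f σ e) ∧
      (∀ e i, g e i ≠ 0 → σ.symm e ≤ σ.symm i) ∧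
      m ⬝ᵥ x - m ⬝ᵥ greedyAlong f σ ≤
        ∑ e, ∑ i with ((i : Fin L) : WithBot (Fin L)) ≤ rho m x e, gap m e i * g e i := by
  obtain ⟨g, h0, h1, h2, h3⟩ := exists_monotone_coupling hf hx σ
  refine ⟨g, h0, h1, h3, ?_⟩
  calc m ⬝ᵥ x - m ⬝ᵥ greedyAlong f σ = ∑ e, ∑ i, gap m e i * g e i := by
        simp only [dotProduct, gap, sub_mul, Finset.sum_sub_distrib, ← h1, ← h2, Finset.mul_sum]
        rw [Finset.sum_comm]
    _ ≤ _ := by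
        refine Finset.sum_le_sum fun e _ => ?_
        rw [Finset.sum_filter]
        refine Finset.sum_le_sum fun i _ => ?_
        split_ifs with hi
        · exact le_rfl
        · rcases le_or_gt (m i) (m e) with hm | hm
          · exact mul_nonpos_of_nonpos_of_nonneg (sub_nonpos.2 hm) (h0 e i)
          · have hxi : x i = 0 := by
              by_contra hne
              exact hi (Finset.le_max (by simp [hm, lt_of_le_of_ne (hx.nonneg i) (Ne.symm hne)]))
            have hg : g e i = 0 :=
              (Finset.sum_eq_zero_iff_of_nonneg fun e _ => h0 e i).1 ((h2 i).trans hxi) e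
                (Finset.mem_univ e)
            rw [hg, mul_zero]

/-! ### The regret on a fixed weight sequence -/

lemma lt_of_rho_eq {L : ℕ} {m x : Fin L → ℝ} {e r : Fin L} (h : rho m x e = r) : m e < m r := by
  have := Finset.mem_of_max h
  simp only [Finset.mem_filter] at this
  exact this.2.1

lemma gap_pos_of_le_rho {L : ℕ} {m x : Fin L → ℝ} (hm : Antitone m) {e i : Fin L}
    (h : (i : WithBot (Fin L)) ≤ rho m x e) : 0 < gap m e i := by
  obtain ⟨r, hr, hir⟩ := WithBot.coe_le_iff.1 h
  exact sub_pos.2 ((lt_of_rho_eq hr).trans_le (hm hir))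

/-- The statistics overestimate the weight of `e` by at least the confidence radius. -/
def upperFailure {L : ℕ} (f : Finset (Fin L) → ℝ) (G : SortRule L) (m : Fin L → ℝ) (t : ℕ)
    (e : Fin L) : Set (ℕ → Fin L → ℝ) :=
  {v | m e + radius t ((opmStats f G v t).count e) ≤ (opmStats f G v t).est e}

/-- The statistics underestimate the weight of `e` by at least the confidence radius. -/
def lowerFailure {L : ℕ} (f : Finset (Fin L) → ℝ) (G : SortRule L) (m : Fin L → ℝ) (t : ℕ)
    (e : Fin L) : Set (ℕ → Fin L → ℝ) :=
  {v | (opmStats f G v t).est e ≤ m e - radius t ((opmStats f G v t).count e)}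

/-- When `e` has been observed often, its confidence radius is at most half the gap, and the upper
confidence bounds of `e` and `i` are in the right order unless an estimate fails. -/
lemma ucb_lt_ucb {L : ℕ} {m : Fin L → ℝ} {S : Stats L} {e i : Fin L} {t n : ℕ} (htn : t ≤ n)
    (hgap : 0 < gap m e i) (hcount : 8 * Real.log n / gap m e i ^ 2 < S.count e)
    (hu : S.est e < m e + radius t (S.count e)) (hl : m i - radius t (S.count i) < S.est i) :
    ucb t S e < ucb t S i := by
  have hlog : Real.log t ≤ Real.log n := by
    rcases Nat.eq_zero_or_pos t with rfl | ht
    · simpa using Real.log_natCast_nonneg n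
    · exact Real.log_le_log (by exact_mod_cast ht) (by exact_mod_cast htn)
  have hc : (0 : ℝ) < S.count e :=
    lt_of_le_of_lt (by have := Real.log_natCast_nonneg n; positivity) hcount
  have hr : radius t (S.count e) ≤ gap m e i / 2 := by
    refine Real.sqrt_le_iff.2 ⟨by positivity, ?_⟩
    rw [div_lt_iff₀ (by positivity)] at hcount
    rw [div_le_iff₀ hc]
    nlinarith
  simp only [ucb]
  have : gap m e i = m i - m e := rfl
  linarith

/-- Charging `√(K / s)` to the observation number `s` of an item, for the observations up to number
`l`, costs at most `2 √K √l` in total, because `1 / √s ≤ 2 (√s - √(s - 1))`. -/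
lemma sum_le_two_mul_sqrt_mul_sqrt {c : ℕ → ℕ} {h : ℕ → ℝ} {K l : ℝ} (hK : 0 ≤ K)
    (hl : 0 ≤ l) (hc0 : c 0 = 1) (hc : ∀ t, c t ≤ c (t + 1))
    (hh : ∀ t, h t ≤ 0 ∨ c (t + 1) = c t + 1 ∧ (c t : ℝ) ≤ l ∧ h t ≤ √(K / c t)) (N : ℕ) :
    ∑ t ∈ Finset.range N, h t ≤ 2 * √K * √l := by
  have hc1 : ∀ t, 1 ≤ c t := fun t => by
    induction t with
    | zero => exact hc0.ge
    | succ t ih => exact ih.trans (hc t)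
  suffices H : ∑ t ∈ Finset.range N, h t ≤ 2 * √K * √(min ((c N : ℝ) - 1) l) from
    H.trans (mul_le_mul_of_nonneg_left (Real.sqrt_le_sqrt (min_le_right _ _)) (by positivity))
  induction N with
  | zero => simp [hc0, hl]
  | succ N ih =>
    rw [Finset.sum_range_succ]
    rcases hh N with h0 | ⟨h1, h2, h3⟩
    · have hmono : √(min ((c N : ℝ) - 1) l) ≤ √(min ((c (N + 1) : ℝ) - 1) l) := by
        have : (c N : ℝ) ≤ c (N + 1) := by exact_mod_cast hc N
        gcongr
      have := mul_le_mul_of_nonneg_left hmono (show 0 ≤ 2 * √K by positivity)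
      linarith
    · have hs : (1 : ℝ) ≤ c N := by exact_mod_cast hc1 N
      set s : ℝ := (c N : ℝ)
      have e1 : min ((c (N + 1) : ℝ) - 1) l = s := by
        rw [h1]; push_cast; rw [add_sub_cancel_right]; exact min_eq_left h2
      have e2 : min (s - 1) l = s - 1 := min_eq_left (by linarith)
      rw [e1]
      rw [e2] at ih
      have key : 1 / √s ≤ 2 * (√s - √(s - 1)) := by
        have hp : 0 < √s := Real.sqrt_pos.2 (by linarith)
        have q1 : √s * √s = s := Real.mul_self_sqrt (by linarith)
        have q2 : √(s - 1) * √(s - 1) = s - 1 := Real.mul_self_sqrt (by linarith)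
        rw [div_le_iff₀ hp]
        nlinarith [sq_nonneg (√s - √(s - 1))]
      have h4 : √(K / s) = √K * (1 / √s) := by
        rw [Real.sqrt_div hK]; ring
      have := mul_le_mul_of_nonneg_left key (Real.sqrt_nonneg K)
      rw [h4] at h3
      linarith

section
variable {L : ℕ} (f : Finset (Fin L) → ℝ) (G : SortRule L) (v : ℕ → Fin L → ℝ)

lemma count_succ (t : ℕ) (e : Fin L) : (opmStats f G v (t + 1)).count e =
    if 0 < opmBasis f G v t e then (opmStats f G v t).count e + 1
    else (opmStats f G v t).count e := rfl

lemma count_le_count_succ (t : ℕ) (e : Fin L) :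
    (opmStats f G v t).count e ≤ (opmStats f G v (t + 1)).count e := by
  rw [count_succ]; split_ifs <;> omega

lemma one_le_count (t : ℕ) (e : Fin L) : 1 ≤ (opmStats f G v t).count e := by
  induction t with
  | zero => exact le_rfl
  | succ t ih => exact ih.trans (count_le_count_succ f G v t e)

lemma count_le (t : ℕ) (e : Fin L) : (opmStats f G v t).count e ≤ t + 1 := by
  induction t with
  | zero => exact le_rfl
  | succ t ih => rw [count_succ]; split_ifs <;> omega

end

/-- The regret on the single weight sequence `v`, measured by the expected weights: the losses in
the episodes without failures are bounded by the logarithmic term, and every failure costs at most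
the gap. -/
lemma sum_loss_le {L : ℕ} {f : Finset (Fin L) → ℝ} (hf : IsPolymatroid f) (G : SortRule L)
    {m x : Fin L → ℝ} (hm : Antitone m) (hx : IsBase f x) (v : ℕ → Fin L → ℝ) (n : ℕ) :
    ∑ t ∈ Finset.range n, (m ⬝ᵥ x - m ⬝ᵥ opmBasis f G v t) ≤
      (∑ e : Fin L, ∑ r with rho m x e = ((r : Fin L) : WithBot (Fin L)),
        16 / gap m e r * Real.log n) +
      ∑ e : Fin L, ∑ i with ((i : Fin L) : WithBot (Fin L)) ≤ rho m x e, gap m e i *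
        ∑ t ∈ Finset.range n,
          (upperFailure f G m t e ∪ lowerFailure f G m t i).indicator (fun _ => (1 : ℝ)) v := by
  classical
  choose g g_nonneg g_sum g_supp g_loss using fun t =>
    exists_loss_decomposition hf hx m (G.order (ucb t (opmStats f G v t)))
  set K : ℝ := 8 * Real.log n with hKdef
  have hK : 0 ≤ K := by have := Real.log_natCast_nonneg n; positivity
  have hbase : ∀ t, IsBase f (opmBasis f G v t) := fun t => isBase_greedyAlong hf _
  have g_sum' : ∀ t e, ∑ i, g t e i = opmBasis f G v t e := g_sum
  have g_le : ∀ t e i, g t e i ≤ opmBasis f G v t e := fun t e i => by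
    rw [← g_sum']
    exact Finset.single_le_sum (fun i _ => g_nonneg t e i) (Finset.mem_univ i)
  -- the losses that are charged to an item with few observations
  let h : Fin L → ℕ → ℝ := fun e t =>
    ∑ i with ((i : Fin L) : WithBot (Fin L)) ≤ rho m x e,
      if ((opmStats f G v t).count e : ℝ) ≤ K / gap m e i ^ 2 then gap m e i * g t e i else 0
  have hstep : ∀ t ∈ Finset.range n, m ⬝ᵥ x - m ⬝ᵥ opmBasis f G v t ≤ ∑ e, (h e t +
      ∑ i with ((i : Fin L) : WithBot (Fin L)) ≤ rho m x e, gap m e i *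
        (upperFailure f G m t e ∪ lowerFailure f G m t i).indicator (fun _ => (1 : ℝ)) v) := by
    intro t ht
    refine (g_loss t).trans (Finset.sum_le_sum fun e _ => ?_)
    simp only [h]
    rw [← Finset.sum_add_distrib]
    refine Finset.sum_le_sum fun i hi => ?_
    have hgap := gap_pos_of_le_rho hm (Finset.mem_filter.1 hi).2
    have hind : 0 ≤ (upperFailure f G m t e ∪ lowerFailure f G m t i).indicator
      (fun _ => (1 : ℝ)) v := Set.indicator_nonneg (fun _ _ => zero_le_one) _
    split_ifs with hc
    · exact le_add_of_nonneg_right (mul_nonneg hgap.le hind)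
    · rw [zero_add]
      refine mul_le_mul_of_nonneg_left ?_ hgap.le
      by_cases hfail : v ∈ upperFailure f G m t e ∪ lowerFailure f G m t i
      · rw [Set.indicator_of_mem hfail]
        exact (g_le t e i).trans ((hbase t).le_one hf e)
      · by_contra hlt
        have hg : g t e i ≠ 0 := fun h0 => hlt (h0 ▸ hind)
        rw [Set.mem_union, not_or] at hfail
        have h1 := ucb_lt_ucb (Finset.mem_range.1 ht).le hgap (not_le.1 hc)
          (not_le.1 hfail.1) (not_le.1 hfail.2)
        have h2 := G.antitone (ucb t (opmStats f G v t)) (g_supp t e i hg)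
        simp only [Equiv.apply_symm_apply] at h2
        exact absurd h1 (not_lt.2 h2)
  have hlog : ∀ e, ∑ t ∈ Finset.range n, h e t ≤
      ∑ r with rho m x e = ((r : Fin L) : WithBot (Fin L)), 16 / gap m e r * Real.log n := by
    intro e
    rcases hr : rho m x e with _ | r
    · have : ∀ t, h e t = 0 := fun t => by
        refine Finset.sum_eq_zero fun i hi => ?_
        have := (Finset.mem_filter.1 hi).2
        rw [hr] at this
        exact absurd this (by simp [WithBot.none_eq_bot])
      simp [this, WithBot.none_eq_bot]
    · have hr : rho m x e = (r : WithBot (Fin L)) := hr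
      have hfil : (Finset.univ.filter fun r' : Fin L =>
          (WithBot.some r : WithBot (Fin L)) = (r' : WithBot (Fin L))) = {r} := by
        ext r'; simp [eq_comm]
      have hgr : 0 < gap m e r := gap_pos_of_le_rho hm hr.ge
      change _ ≤ ∑ r' with (WithBot.some r : WithBot (Fin L)) = ((r' : Fin L) : WithBot (Fin L)), _
      rw [hfil, Finset.sum_singleton]
      have hmain := sum_le_two_mul_sqrt_mul_sqrt (c := fun t => (opmStats f G v t).count e)
        (h := h e) (l := K / gap m e r ^ 2) hK (by positivity) rfl
        (fun t => count_le_count_succ f G v t e) (fun t => ?_) n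
      · refine hmain.trans_eq ?_
        rw [Real.sqrt_div hK, Real.sqrt_sq hgr.le, mul_assoc, ← mul_div_assoc,
          Real.mul_self_sqrt hK, hKdef]
        ring
      · have hcpos : (0 : ℝ) < (opmStats f G v t).count e := by
          exact_mod_cast one_le_count f G v t e
        by_cases hb : 0 < opmBasis f G v t e
        · by_cases hcl : ((opmStats f G v t).count e : ℝ) ≤ K / gap m e r ^ 2
          · refine Or.inr ⟨by simp only [count_succ, if_pos hb], hcl, ?_⟩
            -- only gaps of size at most `√(K / s)` remain, and the masses sum to at most one
            calc h e t ≤ ∑ i with ((i : Fin L) : WithBot (Fin L)) ≤ rho m x e,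
                  √(K / (opmStats f G v t).count e) * g t e i := by
                  refine Finset.sum_le_sum fun i hi => ?_
                  have hgap := gap_pos_of_le_rho hm (Finset.mem_filter.1 hi).2
                  split_ifs with hc
                  · refine mul_le_mul_of_nonneg_right (Real.le_sqrt_of_sq_le ?_) (g_nonneg _ _ _)
                    rw [le_div_iff₀ (by positivity)] at hc
                    rw [le_div_iff₀ hcpos]
                    linarith
                  · exact mul_nonneg (Real.sqrt_nonneg _) (g_nonneg _ _ _)
              _ ≤ √(K / (opmStats f G v t).count e) * ∑ i, g t e i := by
                  rw [← Finset.mul_sum]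
                  refine mul_le_mul_of_nonneg_left ?_ (Real.sqrt_nonneg _)
                  exact Finset.sum_le_sum_of_subset_of_nonneg (Finset.filter_subset _ _)
                    fun i _ _ => g_nonneg t e i
              _ ≤ √(K / (opmStats f G v t).count e) := by
                  rw [g_sum']
                  exact mul_le_of_le_one_right (Real.sqrt_nonneg _) ((hbase t).le_one hf e)
          · refine Or.inl (Finset.sum_nonpos fun i hi => ?_)
            have hi := (Finset.mem_filter.1 hi).2
            have hgap := gap_pos_of_le_rho hm hi
            -- the gap of `ρ(e)` is the smallest one
            have hir : gap m e r ≤ gap m e i := by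
              rw [hr, WithBot.coe_le_coe] at hi
              exact sub_le_sub_right (hm hi) _
            refine (if_neg fun hc => hcl (hc.trans ?_)).le
            gcongr
        · have h0 : opmBasis f G v t e = 0 := le_antisymm (not_lt.1 hb) ((hbase t).nonneg e)
          refine Or.inl (Finset.sum_nonpos fun i _ => ?_)
          have : g t e i = 0 := le_antisymm (h0 ▸ g_le t e i) (g_nonneg t e i)
          simp [this]
  calc ∑ t ∈ Finset.range n, (m ⬝ᵥ x - m ⬝ᵥ opmBasis f G v t)
      ≤ _ := Finset.sum_le_sum hstep
    _ = ∑ e, ∑ t ∈ Finset.range n, h e t +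
        ∑ e : Fin L, ∑ i with ((i : Fin L) : WithBot (Fin L)) ≤ rho m x e, gap m e i *
        ∑ t ∈ Finset.range n,
          (upperFailure f G m t e ∪ lowerFailure f G m t i).indicator (fun _ => (1 : ℝ)) v := by
        rw [Finset.sum_comm, ← Finset.sum_add_distrib]
        refine Finset.sum_congr rfl fun e _ => ?_
        rw [Finset.sum_add_distrib]
        congr 1
        rw [Finset.sum_comm]
        simp only [Finset.mul_sum]
    _ ≤ _ := add_le_add_left (Finset.sum_le_sum fun e _ => hlog e) _

/-! ### Measurability and independence of the past -/

/-- Whatever is determined by the first terms of an independent sequence is independent of the next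
term. -/
lemma indepFun_of_dependsOn {E Ω β : Type*} [MeasurableSpace E] [Inhabited E] [MeasurableSpace Ω]
    [MeasurableSpace β] {μ : Measure Ω} {w : ℕ → Ω → E} (hw : ∀ t, Measurable (w t))
    (hindep : iIndepFun w μ) {F : (ℕ → E) → β} (hF : Measurable F) {t : ℕ}
    (hd : DependsOn F (Set.Iic t)) : IndepFun (fun ω => F fun s => w s ω) (w (t + 1)) μ := by
  classical
  have h := hindep.indepFun_finset (Finset.Iic t) {t + 1} (by simp) hw
  let extend : (Finset.Iic t → E) → ℕ → E := fun p s =>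
    if hs : s ∈ Finset.Iic t then p ⟨s, hs⟩ else default
  have hext : Measurable extend := by
    refine measurable_pi_iff.2 fun s => ?_
    by_cases hs : s ∈ Finset.Iic t
    · simp only [extend, dif_pos hs]; exact measurable_pi_apply _
    · simp only [extend, dif_neg hs]; exact measurable_const
  have h' := h.comp (hF.comp hext)
    (measurable_pi_apply (⟨t + 1, Finset.mem_singleton_self _⟩ : ({t + 1} : Finset ℕ)))
  have hFext : (fun ω => F fun s => w s ω) = (F ∘ extend) ∘ fun ω i => w i ω := by
    funext ω
    refine hd fun s hs => ?_
    have hs' : s ∈ Finset.Iic t := Finset.mem_Iic.2 hs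
    simp only [extend, dif_pos hs']
  rw [hFext]
  exact h'

section Measurability
variable {L : ℕ} (f : Finset (Fin L) → ℝ) (G : SortRule L)

lemma measurable_greedy (e : Fin L) : Measurable fun u => greedy f G u e := by
  classical
  have : (fun u => greedy f G u e) = fun u =>
      ∑ σ, {u | G.order u = σ}.indicator (fun _ => greedyAlong f σ e) u := by
    funext u
    simp [Set.indicator_apply, greedy]
  rw [this]
  exact Finset.measurable_sum _ fun σ _ => measurable_const.indicator (G.measurableSet_order σ)

lemma measurable_ucb {α : Type*} [MeasurableSpace α] {S : α → Stats L} (t : ℕ)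
    (hc : ∀ e, Measurable fun a => (S a).count e) (he : ∀ e, Measurable fun a => (S a).est e) :
    Measurable fun a => ucb t (S a) :=
  measurable_pi_iff.2 fun e => (he e).add ((measurable_of_countable (radius t)).comp (hc e))

lemma measurable_opmStats (t : ℕ) :
    (∀ e, Measurable fun v : ℕ → Fin L → ℝ => (opmStats f G v t).count e) ∧
      ∀ e, Measurable fun v : ℕ → Fin L → ℝ => (opmStats f G v t).est e := by
  have hv : ∀ s (e : Fin L), Measurable fun v : ℕ → Fin L → ℝ => v s e := fun s e =>
    (measurable_pi_apply e).comp (measurable_pi_apply s)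
  induction t with
  | zero => exact ⟨fun e => measurable_const, fun e => hv 0 e⟩
  | succ t ih =>
    have hset : ∀ e, MeasurableSet {v : ℕ → Fin L → ℝ |
        0 < greedy f G (ucb t (opmStats f G v t)) e} := fun e =>
      measurableSet_lt measurable_const
        ((measurable_greedy f G e).comp (measurable_ucb t ih.1 ih.2))
    have hcast : ∀ e, Measurable fun v : ℕ → Fin L → ℝ =>
        (((opmStats f G v t).count e : ℕ) : ℝ) := fun e =>
      (measurable_of_countable (fun k : ℕ => (k : ℝ))).comp (ih.1 e)
    refine ⟨fun e => Measurable.ite (hset e) ((ih.1 e).add_const 1) (ih.1 e), fun e => ?_⟩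
    refine Measurable.ite (hset e) ?_ (ih.2 e)
    exact (((hcast e).mul (ih.2 e)).add (hv _ e)).div
      ((measurable_of_countable (fun k : ℕ => ((k + 1 : ℕ) : ℝ))).comp (ih.1 e))

lemma measurable_opmBasis (t : ℕ) (e : Fin L) : Measurable fun v => opmBasis f G v t e :=
  (measurable_greedy f G e).comp
    (measurable_ucb t (measurable_opmStats f G t).1 (measurable_opmStats f G t).2)

lemma dependsOn_opmStats (t : ℕ) :
    DependsOn (fun v => opmStats f G v t) (Set.Iic t) := by
  induction t with
  | zero =>
    intro v v' h
    simp only [opmStats, h 0 (Set.mem_Iic.2 le_rfl)]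
  | succ t ih =>
    intro v v' h
    have h1 : opmStats f G v t = opmStats f G v' t :=
      ih fun s hs => h s (Set.mem_Iic.2 ((Set.mem_Iic.1 hs).trans (Nat.le_succ t)))
    simp only [opmStats, h1, h (t + 1) (Set.mem_Iic.2 le_rfl)]

end Measurability

/-! ### Concentration of the estimates -/

/-- The exponential supermartingale with exponent `l` for the observations of the item `e`, where
the sum of the deviations of the observed weights from `a` is `count * (est - a)`. -/
noncomputable def expSupermart {L : ℕ} (f : Finset (Fin L) → ℝ) (G : SortRule L) (a l : ℝ) (t : ℕ)
    (e : Fin L) (v : ℕ → Fin L → ℝ) : ENNReal :=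
  ENNReal.ofReal (Real.exp (l * ((opmStats f G v t).count e * ((opmStats f G v t).est e - a)) -
    l ^ 2 / 8 * (opmStats f G v t).count e))

/-- Hoeffding's lemma for the weight of one item. -/
lemma lintegral_exp_le_one {L : ℕ} (P : Measure (Fin L → ℝ)) [IsProbabilityMeasure P]
    (hP : ∀ᵐ v ∂P, ∀ e, v e ∈ Set.Icc (0 : ℝ) 1) (e : Fin L) (l : ℝ) :
    ∫⁻ v, ENNReal.ofReal (Real.exp (l * (v e - meanWeight P e) - l ^ 2 / 8)) ∂P ≤ 1 := by
  have hs := hasSubgaussianMGF_of_mem_Icc (μ := P) (X := fun v => v e)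
    (measurable_pi_apply e).aemeasurable (hP.mono fun v hv => hv e)
  have hm := hs.mgf_le l
  have hi := hs.integrable_exp_mul l
  change Integrable (fun v => Real.exp (l * (v e - meanWeight P e))) P at hi
  change ∫ v, Real.exp (l * (v e - meanWeight P e)) ∂P ≤ _ at hm
  have hexp : ∀ v : Fin L → ℝ, Real.exp (l * (v e - meanWeight P e) - l ^ 2 / 8) =
      Real.exp (l * (v e - meanWeight P e)) * Real.exp (-(l ^ 2 / 8)) := fun v => by
    rw [← Real.exp_add, sub_eq_add_neg]
  simp_rw [hexp]
  rw [← ofReal_integral_eq_lintegral_ofReal (hi.mul_const _)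
    (ae_of_all _ fun v => by positivity), ENNReal.ofReal_le_one, integral_mul_const]
  calc _ ≤ Real.exp (l ^ 2 / 8) * Real.exp (-(l ^ 2 / 8)) := by
        refine mul_le_mul_of_nonneg_right (hm.trans_eq ?_) (Real.exp_pos _).le
        congr 1
        simp
        ring
    _ = 1 := by rw [← Real.exp_add, add_neg_cancel, Real.exp_zero]

section Concentration
variable {L : ℕ} (f : Finset (Fin L) → ℝ) (G : SortRule L) {P : Measure (Fin L → ℝ)}
  [IsProbabilityMeasure P] (hP : ∀ᵐ v ∂P, ∀ e, v e ∈ Set.Icc (0 : ℝ) 1)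
  {Ω : Type*} [MeasurableSpace Ω] {μ : Measure Ω} [IsProbabilityMeasure μ]
  {w : ℕ → Ω → Fin L → ℝ} (hw : ∀ t, Measurable (w t)) (hlaw : ∀ t, μ.map (w t) = P)
  (hindep : iIndepFun w μ)

lemma measurable_expSupermart (a l : ℝ) (t : ℕ) (e : Fin L) :
    Measurable (expSupermart f G a l t e) := by
  have hc : Measurable fun v : ℕ → Fin L → ℝ => (((opmStats f G v t).count e : ℕ) : ℝ) :=
    (measurable_of_countable (fun k : ℕ => (k : ℝ))).comp ((measurable_opmStats f G t).1 e)
  have he := (measurable_opmStats f G t).2 e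
  unfold expSupermart
  fun_prop

lemma expSupermart_succ (a l : ℝ) (t : ℕ) (e : Fin L) (v : ℕ → Fin L → ℝ) :
    expSupermart f G a l (t + 1) e v = if 0 < opmBasis f G v t e then
      expSupermart f G a l t e v *
        ENNReal.ofReal (Real.exp (l * (v (t + 1) e - a) - l ^ 2 / 8))
      else expSupermart f G a l t e v := by
  have hest : (opmStats f G v (t + 1)).est e = if 0 < opmBasis f G v t e then
      ((opmStats f G v t).count e * (opmStats f G v t).est e + v (t + 1) e) /
        ((opmStats f G v t).count e + 1 : ℕ) else (opmStats f G v t).est e := rfl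
  have hcount := count_succ f G v t e
  unfold expSupermart
  split_ifs at * with h
  · rw [hest, hcount, ← ENNReal.ofReal_mul (Real.exp_pos _).le, ← Real.exp_add]
    congr 2
    push_cast
    have : ((opmStats f G v t).count e : ℝ) + 1 ≠ 0 := by positivity
    field_simp
    ring
  · rw [hest, hcount]

include hP hw hlaw hindep

omit [IsProbabilityMeasure μ] in
/-- The weights observed in the next episode are independent of the choice whether to observe them,
so each observation multiplies the expectation by at most one. -/
lemma lintegral_expSupermart_le_one (l : ℝ) (t : ℕ) (e : Fin L) :
    ∫⁻ ω, expSupermart f G (meanWeight P e) l t e (fun s => w s ω) ∂μ ≤ 1 := by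
  classical
  set Y : (Fin L → ℝ) → ENNReal := fun u =>
    ENNReal.ofReal (Real.exp (l * (u e - meanWeight P e) - l ^ 2 / 8)) with hY
  have hYm : Measurable Y := by simp only [hY]; fun_prop
  have hYint : ∀ t, ∫⁻ ω, Y (w t ω) ∂μ ≤ 1 := fun t => by
    rw [← lintegral_map hYm (hw t), hlaw t]
    exact lintegral_exp_le_one P hP e l
  have hW : Measurable fun ω s => w s ω := measurable_pi_iff.2 hw
  induction t with
  | zero =>
    refine le_of_eq_of_le (lintegral_congr fun ω => ?_) (hYint 0)
    simp [expSupermart, opmStats, hY]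
  | succ t ih =>
    set M := expSupermart f G (meanWeight P e) l t e with hM
    have hMm : Measurable M := measurable_expSupermart f G _ l t e
    have hA : MeasurableSet {v : ℕ → Fin L → ℝ | 0 < opmBasis f G v t e} :=
      measurableSet_lt measurable_const (measurable_opmBasis f G t e)
    set A := {v : ℕ → Fin L → ℝ | 0 < opmBasis f G v t e} with hAdef
    have hind : IndepFun (fun ω => A.indicator M fun s => w s ω) (fun ω => Y (w (t + 1) ω)) μ := by
      refine (indepFun_of_dependsOn hw hindep (hMm.indicator hA) (t := t) fun v v' h => ?_).comp
        measurable_id hYm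
      have hS : opmStats f G v t = opmStats f G v' t := dependsOn_opmStats f G t h
      simp [Set.indicator_apply, hAdef, hM, expSupermart, opmBasis, hS]
    have hM2 : Measurable fun ω => Aᶜ.indicator M fun s => w s ω :=
      (hMm.indicator hA.compl).comp hW
    calc ∫⁻ ω, expSupermart f G (meanWeight P e) l (t + 1) e (fun s => w s ω) ∂μ
        = ∫⁻ ω, A.indicator M (fun s => w s ω) * Y (w (t + 1) ω) +
            Aᶜ.indicator M (fun s => w s ω) ∂μ := by
          refine lintegral_congr fun ω => ?_
          rw [expSupermart_succ]
          by_cases h : 0 < opmBasis f G (fun s => w s ω) t e <;>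
            simp [hAdef, h, hY, hM]
      _ = (∫⁻ ω, A.indicator M (fun s => w s ω) ∂μ) * (∫⁻ ω, Y (w (t + 1) ω) ∂μ) +
            ∫⁻ ω, Aᶜ.indicator M (fun s => w s ω) ∂μ := by
          rw [lintegral_add_right _ hM2]
          congr 1
          exact lintegral_mul_eq_lintegral_mul_lintegral_of_indepFun
            ((hMm.indicator hA).comp hW) (hYm.comp (hw _)) hind
      _ ≤ (∫⁻ ω, A.indicator M (fun s => w s ω) ∂μ) +
            ∫⁻ ω, Aᶜ.indicator M (fun s => w s ω) ∂μ := by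
          gcongr
          exact mul_le_of_le_one_right zero_le (hYint _)
      _ = ∫⁻ ω, M (fun s => w s ω) ∂μ := by
          rw [← lintegral_add_right _ hM2]
          refine lintegral_congr fun ω => ?_
          exact congrFun (Set.indicator_self_add_compl A M) _
      _ ≤ 1 := ih

omit [IsProbabilityMeasure μ] in
/-- The tail bound for a fixed number `s` of observations; the optimal exponents are `± 4` times the
confidence radius, for the two tails. -/
lemma measureReal_deviation_le {t s : ℕ} (ht : 1 ≤ t) (hs : 1 ≤ s) (e : Fin L) {l : ℝ}
    (hl : l ^ 2 = (4 * radius t s) ^ 2) :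
    μ.real {ω | (opmStats f G (fun r => w r ω) t).count e = s ∧
      4 * radius t s ^ 2 ≤ l * ((opmStats f G (fun r => w r ω) t).est e - meanWeight P e)} ≤
        1 / (t : ℝ) ^ 4 := by
  have ht0 : (0 : ℝ) < t := by exact_mod_cast ht
  have hs0 : (0 : ℝ) < s := by exact_mod_cast hs
  have hW : Measurable fun ω s => w s ω := measurable_pi_iff.2 hw
  have hr : radius t s ^ 2 = 2 * Real.log t / s :=
    Real.sq_sqrt (by have := Real.log_natCast_nonneg t; positivity)
  have hlower : ∀ ω, (opmStats f G (fun r => w r ω) t).count e = s ∧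
      4 * radius t s ^ 2 ≤ l * ((opmStats f G (fun r => w r ω) t).est e - meanWeight P e) →
      ENNReal.ofReal ((t : ℝ) ^ 4) ≤
        expSupermart f G (meanWeight P e) l t e (fun s => w s ω) := by
    rintro ω ⟨h1, h2⟩
    refine ENNReal.ofReal_le_ofReal ?_
    rw [h1]
    have : (t : ℝ) ^ 4 = Real.exp (4 * Real.log t) := by
      rw [mul_comm, Real.exp_mul, Real.exp_log ht0]; norm_cast
    rw [this, Real.exp_le_exp]
    have h3 := mul_le_mul_of_nonneg_right h2 hs0.le
    have h4 : radius t s ^ 2 * s = 2 * Real.log t := by rw [hr]; field_simp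
    have h5 : l ^ 2 / 8 * s = 4 * Real.log t := by rw [hl]; linarith
    rw [h5]
    linarith
  refine ENNReal.toReal_le_of_le_ofReal (by positivity) ?_
  calc _ ≤ μ {ω | ENNReal.ofReal ((t : ℝ) ^ 4) ≤
        expSupermart f G (meanWeight P e) l t e (fun s => w s ω)} := measure_mono hlower
    _ ≤ (∫⁻ ω, expSupermart f G (meanWeight P e) l t e (fun s => w s ω) ∂μ) /
        ENNReal.ofReal ((t : ℝ) ^ 4) :=
      meas_ge_le_lintegral_div
        ((measurable_expSupermart f G _ l t e).comp hW).aemeasurable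
        (by simpa using ht0.ne') ENNReal.ofReal_ne_top
    _ ≤ 1 / ENNReal.ofReal ((t : ℝ) ^ 4) := by
      gcongr
      exact lintegral_expSupermart_le_one f G hP hw hlaw hindep l t e
    _ = ENNReal.ofReal (1 / (t : ℝ) ^ 4) := by
      rw [ENNReal.ofReal_div_of_pos (by positivity), ENNReal.ofReal_one]

/-- A union bound over the number of observations. -/
lemma measureReal_le_of_deviation {t : ℕ} (ht : 1 ≤ t) (e : Fin L) {q : ℝ} (hq : q ^ 2 = 1)
    {B : Set (ℕ → Fin L → ℝ)} (hB : ∀ v ∈ B, radius t ((opmStats f G v t).count e) ≤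
      q * ((opmStats f G v t).est e - meanWeight P e)) :
    μ.real {ω | (fun s => w s ω) ∈ B} ≤ (t + 1) / (t : ℝ) ^ 4 := by
  calc μ.real {ω | (fun s => w s ω) ∈ B}
      ≤ μ.real (⋃ s ∈ Finset.Icc 1 (t + 1),
          {ω | (opmStats f G (fun r => w r ω) t).count e = s ∧ 4 * radius t s ^ 2 ≤
            q * (4 * radius t s) *
              ((opmStats f G (fun r => w r ω) t).est e - meanWeight P e)}) := by
        refine measureReal_mono (fun ω hω => ?_) (measure_ne_top _ _)
        simp only [Set.mem_iUnion, Set.mem_ofPred_eq]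
        refine ⟨_, Finset.mem_Icc.2 ⟨one_le_count f G _ t e, count_le f G _ t e⟩, rfl, ?_⟩
        have := mul_le_mul_of_nonneg_left (hB _ hω)
          (Real.sqrt_nonneg (2 * Real.log t / ((opmStats f G (fun r => w r ω) t).count e : ℕ)))
        change radius t _ * _ ≤ radius t _ * _ at this
        linarith
    _ ≤ ∑ s ∈ Finset.Icc 1 (t + 1), 1 / (t : ℝ) ^ 4 :=
        (measureReal_biUnion_finset_le _ _).trans (Finset.sum_le_sum fun s hs =>
          measureReal_deviation_le f G hP hw hlaw hindep ht (Finset.mem_Icc.1 hs).1 e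
            (by rw [mul_pow, hq, one_mul]))
    _ = (t + 1) / (t : ℝ) ^ 4 := by
        simp only [Finset.sum_const, Nat.card_Icc, nsmul_eq_mul]; push_cast; ring

lemma measureReal_failure_le {t : ℕ} (ht : 1 ≤ t) (e i : Fin L) :
    μ.real {ω | (fun s => w s ω) ∈ upperFailure f G (meanWeight P) t e ∪
      lowerFailure f G (meanWeight P) t i} ≤ 2 * ((t + 1) / (t : ℝ) ^ 4) := by
  have h1 := measureReal_le_of_deviation f G hP hw hlaw hindep ht e (q := 1) (by norm_num)
    (B := upperFailure f G (meanWeight P) t e) fun v hv => by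
      simp only [upperFailure, Set.mem_ofPred_eq] at hv
      linarith
  have h2 := measureReal_le_of_deviation f G hP hw hlaw hindep ht i (q := -1) (by norm_num)
    (B := lowerFailure f G (meanWeight P) t i) fun v hv => by
      simp only [lowerFailure, Set.mem_ofPred_eq] at hv
      linarith
  have h3 := measureReal_union_le (μ := μ)
    {ω | (fun s => w s ω) ∈ upperFailure f G (meanWeight P) t e}
    {ω | (fun s => w s ω) ∈ lowerFailure f G (meanWeight P) t i}
  calc _ ≤ _ := h3
    _ ≤ _ := by linarith

/-- The expected number of failures: one for the first episode, in which the confidence radius is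
zero, and `2 (t + 1) / t ^ 4 ≤ 4 / t ^ 2` for each later one. -/
lemma sum_measureReal_failure_le (n : ℕ) (e i : Fin L) :
    ∑ t ∈ Finset.range n, μ.real {ω | (fun s => w s ω) ∈
      upperFailure f G (meanWeight P) t e ∪ lowerFailure f G (meanWeight P) t i} ≤
      4 / 3 * Real.pi ^ 2 := by
  have hterm : ∀ t, μ.real {ω | (fun s => w s ω) ∈ upperFailure f G (meanWeight P) t e ∪
      lowerFailure f G (meanWeight P) t i} ≤ (if t = 0 then 1 else 0) +
        4 * (1 / (t : ℝ) ^ 2) := fun t => by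
    rcases Nat.eq_zero_or_pos t with rfl | ht
    · simp
    · rw [if_neg ht.ne', zero_add]
      refine (measureReal_failure_le f G hP hw hlaw hindep ht e i).trans ?_
      have ht1 : (1 : ℝ) ≤ t := by exact_mod_cast ht
      rw [← mul_div_assoc, mul_one_div, div_le_div_iff₀ (by positivity) (by positivity)]
      have h2 : (t : ℝ) + 1 ≤ 2 * t ^ 2 := by nlinarith
      have h3 := mul_le_mul_of_nonneg_right h2 (show (0 : ℝ) ≤ 2 * t ^ 2 by positivity)
      nlinarith
  calc _ ≤ ∑ t ∈ Finset.range n, ((if t = 0 then 1 else 0) + 4 * (1 / (t : ℝ) ^ 2)) :=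
        Finset.sum_le_sum fun t _ => hterm t
    _ ≤ 1 + 4 * (Real.pi ^ 2 / 6) := by
        rw [Finset.sum_add_distrib, ← Finset.mul_sum]
        gcongr
        · rw [Finset.sum_ite_eq']; split_ifs <;> norm_num
        · exact sum_le_hasSum _ (fun t _ => by positivity) hasSum_zeta_two
    _ ≤ 4 / 3 * Real.pi ^ 2 := by nlinarith [Real.pi_gt_three]

end Concentration

/-! ### The expected regret -/

section Expectation
variable {L : ℕ} {f : Finset (Fin L) → ℝ} (G : SortRule L) {P : Measure (Fin L → ℝ)}
  [IsProbabilityMeasure P] {Ω : Type*} [MeasurableSpace Ω] {μ : Measure Ω}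
  [IsProbabilityMeasure μ] {w : ℕ → Ω → Fin L → ℝ}

lemma measurableSet_failure (m : Fin L → ℝ) (t : ℕ) (e i : Fin L) :
    MeasurableSet (upperFailure f G m t e ∪ lowerFailure f G m t i) := by
  have hr : ∀ e, Measurable fun v : ℕ → Fin L → ℝ => radius t ((opmStats f G v t).count e) :=
    fun e => (measurable_of_countable (radius t)).comp ((measurable_opmStats f G t).1 e)
  exact (measurableSet_le ((hr e).const_add _) ((measurable_opmStats f G t).2 e)).union
    (measurableSet_le ((measurable_opmStats f G t).2 i) ((hr i).const_sub _))

omit [IsProbabilityMeasure P] in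
lemma integrable_weight (hP : ∀ᵐ v ∂P, ∀ e, v e ∈ Set.Icc (0 : ℝ) 1)
    (hw : ∀ t, Measurable (w t)) (hlaw : ∀ t, μ.map (w t) = P) (t : ℕ) (e : Fin L) :
    Integrable (fun ω => w t ω e) μ := by
  refine Integrable.of_mem_Icc 0 1 ((measurable_pi_apply e).comp (hw t)).aemeasurable ?_
  have := ae_of_ae_map (hw t).aemeasurable ((hlaw t).symm ▸ hP)
  exact this.mono fun ω h => h e

omit [IsProbabilityMeasure P] [IsProbabilityMeasure μ] in
lemma integral_weight (hw : ∀ t, Measurable (w t)) (hlaw : ∀ t, μ.map (w t) = P) (t : ℕ)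
    (e : Fin L) : ∫ ω, w t ω e ∂μ = meanWeight P e := by
  rw [meanWeight, ← hlaw t, integral_map (hw t).aemeasurable
    (measurable_pi_apply e).aestronglyMeasurable]

lemma integrable_opmBasis (hf : IsPolymatroid f) (hw : ∀ t, Measurable (w t)) (t : ℕ)
    (e : Fin L) : Integrable (fun ω => opmBasis f G (fun s => w s ω) t e) μ := by
  refine Integrable.of_mem_Icc 0 1
    ((measurable_opmBasis f G t e).comp (measurable_pi_iff.2 hw)).aemeasurable
    (ae_of_all _ fun ω => ?_)
  have h := isBase_greedyAlong hf (G.order (ucb t (opmStats f G (fun s => w s ω) t)))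
  exact ⟨h.nonneg e, h.le_one hf e⟩

omit [IsProbabilityMeasure μ] in
lemma indepFun_opmBasis (hw : ∀ t, Measurable (w t)) (hindep : iIndepFun w μ) (t : ℕ)
    (e : Fin L) :
    IndepFun (fun ω => w (t + 1) ω e) (fun ω => opmBasis f G (fun s => w s ω) t e) μ := by
  refine ((indepFun_of_dependsOn hw hindep (measurable_opmBasis f G t e) (t := t)
    fun v v' h => ?_).comp measurable_id (measurable_pi_apply e)).symm
  have hS : opmStats f G v t = opmStats f G v' t := dependsOn_opmStats f G t h
  simp only [opmBasis, hS]

omit [IsProbabilityMeasure P] in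
/-- The weights in an episode are independent of the basis chosen in it, so that the expected loss
can be computed with the expected weights. -/
lemma integrable_and_integral_loss (hf : IsPolymatroid f)
    (hP : ∀ᵐ v ∂P, ∀ e, v e ∈ Set.Icc (0 : ℝ) 1) (hw : ∀ t, Measurable (w t))
    (hlaw : ∀ t, μ.map (w t) = P) (hindep : iIndepFun w μ) (x : Fin L → ℝ) (t : ℕ) :
    Integrable (fun ω => w (t + 1) ω ⬝ᵥ x -
        w (t + 1) ω ⬝ᵥ opmBasis f G (fun s => w s ω) t) μ ∧
      Integrable (fun ω => meanWeight P ⬝ᵥ x -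
        meanWeight P ⬝ᵥ opmBasis f G (fun s => w s ω) t) μ ∧
      ∫ ω, (w (t + 1) ω ⬝ᵥ x - w (t + 1) ω ⬝ᵥ opmBasis f G (fun s => w s ω) t) ∂μ =
        ∫ ω, (meanWeight P ⬝ᵥ x - meanWeight P ⬝ᵥ opmBasis f G (fun s => w s ω) t) ∂μ := by
  have iw := fun e => (integrable_weight hP hw hlaw (t + 1) e).mul_const (x e)
  have ib := integrable_opmBasis (μ := μ) G hf hw t
  have iwb : ∀ e, Integrable
      (fun ω => w (t + 1) ω e * opmBasis f G (fun s => w s ω) t e) μ := fun e =>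
    (indepFun_opmBasis G hw hindep t e).integrable_mul
      (integrable_weight hP hw hlaw (t + 1) e) (ib e)
  have imb := fun e => (ib e).const_mul (meanWeight P e)
  have I1 := integrable_finsetSum Finset.univ fun e _ => iw e
  have I2 := integrable_finsetSum Finset.univ fun e _ => iwb e
  have I3 := integrable_finsetSum Finset.univ fun e _ => imb e
  refine ⟨I1.sub I2, (integrable_const _).sub I3, ?_⟩
  simp only [dotProduct]
  rw [integral_sub I1 I2, integral_sub (integrable_const _) I3,
    integral_finsetSum _ fun e _ => iw e, integral_finsetSum _ fun e _ => iwb e,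
    integral_finsetSum _ fun e _ => imb e]
  congr 1
  · simp [integral_mul_const, integral_weight hw hlaw]
  · refine Finset.sum_congr rfl fun e _ => ?_
    rw [integral_const_mul, ← integral_weight hw hlaw (t + 1) e]
    exact (indepFun_opmBasis G hw hindep t e).integral_mul_eq_mul_integral
      (integrable_weight hP hw hlaw (t + 1) e).aestronglyMeasurable (ib e).aestronglyMeasurable

lemma integral_opmRegret_le (hf : IsPolymatroid f)
    (hP : ∀ᵐ v ∂P, ∀ e, v e ∈ Set.Icc (0 : ℝ) 1) (hord : Antitone (meanWeight P))
    (hw : ∀ t, Measurable (w t)) (hlaw : ∀ t, μ.map (w t) = P) (hindep : iIndepFun w μ)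
    {x : Fin L → ℝ} (hx : IsBase f x) (n : ℕ) :
    Integrable (fun ω => opmRegret f G x (fun t => w t ω) n) μ ∧
      ∫ ω, opmRegret f G x (fun t => w t ω) n ∂μ ≤ regretBound (meanWeight P) x n := by
  have hloss := integrable_and_integral_loss (f := f) G hf hP hw hlaw hindep x
  refine ⟨integrable_finsetSum _ fun t _ => (hloss t).1, ?_⟩
  set m := meanWeight P
  have hW : Measurable fun ω s => w s ω := measurable_pi_iff.2 hw
  have hF : ∀ t e i, MeasurableSet {ω | (fun s => w s ω) ∈
      upperFailure f G m t e ∪ lowerFailure f G m t i} := fun t e i =>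
    hW (measurableSet_failure G m t e i)
  have hind : ∀ t e i, (fun ω => (upperFailure f G m t e ∪ lowerFailure f G m t i).indicator
      (fun _ => (1 : ℝ)) fun s => w s ω) = {ω | (fun s => w s ω) ∈
      upperFailure f G m t e ∪ lowerFailure f G m t i}.indicator fun _ => (1 : ℝ) :=
    fun t e i => by classical funext ω; rw [Set.indicator_apply, Set.indicator_apply]; rfl
  have iF : ∀ t e i, Integrable (fun ω => (upperFailure f G m t e ∪
      lowerFailure f G m t i).indicator (fun _ => (1 : ℝ)) fun s => w s ω) μ := fun t e i => by
    rw [hind]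
    exact (integrable_const _).indicator (hF t e i)
  have iS : ∀ e i, Integrable (fun ω => gap m e i * ∑ t ∈ Finset.range n,
      (upperFailure f G m t e ∪ lowerFailure f G m t i).indicator
        (fun _ => (1 : ℝ)) fun s => w s ω) μ := fun e i =>
    (integrable_finsetSum _ fun t _ => iF t e i).const_mul _
  have iSS := integrable_finsetSum Finset.univ fun (e : Fin L) _ =>
    integrable_finsetSum (Finset.univ.filter fun i : Fin L =>
      (i : WithBot (Fin L)) ≤ rho m x e) fun i _ => iS e i
  calc ∫ ω, opmRegret f G x (fun t => w t ω) n ∂μ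
      = ∫ ω, ∑ t ∈ Finset.range n,
          (m ⬝ᵥ x - m ⬝ᵥ opmBasis f G (fun s => w s ω) t) ∂μ := by
        simp only [opmRegret]
        rw [integral_finsetSum _ fun t _ => (hloss t).1,
          integral_finsetSum _ fun t _ => (hloss t).2.1]
        exact Finset.sum_congr rfl fun t _ => (hloss t).2.2
    _ ≤ _ := integral_mono (integrable_finsetSum _ fun t _ => (hloss t).2.1)
        ((integrable_const _).add iSS) fun ω => sum_loss_le hf G hord hx (fun s => w s ω) n
    _ ≤ regretBound m x n := by
        simp only [Pi.add_apply]
        rw [integral_add (integrable_const _) iSS, integral_const, probReal_univ, one_smul,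
          regretBound]
        refine add_le_add_right ?_ _
        rw [integral_finsetSum _ fun e _ => integrable_finsetSum _ fun i _ => iS e i]
        refine Finset.sum_le_sum fun e _ => ?_
        rw [integral_finsetSum _ fun i _ => iS e i]
        refine Finset.sum_le_sum fun i hi => ?_
        rw [integral_const_mul, integral_finsetSum _ fun t _ => iF t e i]
        refine mul_le_mul_of_nonneg_left ?_
          (gap_pos_of_le_rho hord (Finset.mem_filter.1 hi).2).le
        simp_rw [hind, integral_indicator_const (1 : ℝ) (hF _ e i), smul_eq_mul, mul_one]
        exact sum_measureReal_failure_le f G hP hw hlaw hindep n e i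

end Expectation

/-! ### Asymptotics of the bound -/

/-- The second sum in the bound is constant, and the first one has at most `L` terms, in each of
which the gap is at least the smallest one. -/
lemma eventually_regretBound_le {L : ℕ} {m x : Fin L → ℝ} (hm : Antitone m) {Δ : ℝ}
    (hΔ : IsLeast {d | ∃ e i : Fin L, (i : WithBot (Fin L)) ≤ rho m x e ∧ d = gap m e i} Δ)
    {C : ℝ} (hC : 16 < C) :
    ∀ᶠ n : ℕ in atTop, regretBound m x n ≤ C * (L * (1 / Δ) * Real.log n) := by
  classical
  obtain ⟨⟨e₀, i₀, h₀, hd⟩, hmin⟩ := hΔ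
  have hΔ0 : 0 < Δ := hd ▸ gap_pos_of_le_rho hm h₀
  have hL : (0 : ℝ) < L := by exact_mod_cast e₀.pos
  set K := ∑ e : Fin L, ∑ i with ((i : Fin L) : WithBot (Fin L)) ≤ rho m x e,
      gap m e i * (4 / 3 * Real.pi ^ 2) with hK
  have htend : Tendsto (fun n : ℕ => (C - 16) * (L * (1 / Δ)) * Real.log n) atTop atTop :=
    (Real.tendsto_log_atTop.comp tendsto_natCast_atTop_atTop).const_mul_atTop
      (mul_pos (sub_pos.2 hC) (by positivity))
  filter_upwards [htend.eventually_ge_atTop K] with n hn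
  have hlog := Real.log_natCast_nonneg n
  have hfirst : ∑ e : Fin L, ∑ r with rho m x e = ((r : Fin L) : WithBot (Fin L)),
      16 / gap m e r * Real.log n ≤ L * (16 / Δ * Real.log n) := by
    calc _ ≤ ∑ _e : Fin L, 16 / Δ * Real.log n := by
          refine Finset.sum_le_sum fun e _ => ?_
          have hcard : (Finset.univ.filter fun r : Fin L =>
              rho m x e = (r : WithBot (Fin L))).card ≤ 1 :=
            Finset.card_le_one.2 fun a ha b hb => WithBot.coe_injective
              ((Finset.mem_filter.1 ha).2.symm.trans (Finset.mem_filter.1 hb).2)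
          have hle := Finset.sum_le_card_nsmul (Finset.univ.filter fun r : Fin L =>
            rho m x e = (r : WithBot (Fin L))) (fun r => 16 / gap m e r * Real.log n)
            (16 / Δ * Real.log n) fun r hr => by
              have := hmin ⟨e, r, (Finset.mem_filter.1 hr).2.ge, rfl⟩
              gcongr
          refine hle.trans ?_
          rw [nsmul_eq_mul]
          exact mul_le_of_le_one_left (by positivity) (by exact_mod_cast hcard)
      _ = L * (16 / Δ * Real.log n) := by simp
  rw [regretBound, ← hK]
  calc _ ≤ L * (16 / Δ * Real.log n) + (C - 16) * (L * (1 / Δ)) * Real.log n :=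
        add_le_add hfirst hn
    _ = C * (L * (1 / Δ) * Real.log n) := by ring

end PolymatroidBandit

theorem mainTheorem1 {L : ℕ} (f : Finset (Fin L) → ℝ) (hf : IsPolymatroid f) (G : SortRule L)
    -- the distribution of the weights, on the unit cube
    (P : Measure (Fin L → ℝ)) [IsProbabilityMeasure P]
    (hP : ∀ᵐ v ∂P, ∀ e, v e ∈ Set.Icc (0 : ℝ) 1)
    -- the items are listed in the order of decreasing expected weight
    (hord : Antitone (meanWeight P))
    -- an optimal solution
    (x : Fin L → ℝ) (hx : IsOptimal f G (meanWeight P) x)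
    -- the i.i.d. weights `w 0, w 1, …` with distribution `P`
    {Ω : Type*} [MeasurableSpace Ω] (μ : Measure Ω) [IsProbabilityMeasure μ]
    (w : ℕ → Ω → Fin L → ℝ) (hw : ∀ t, Measurable (w t)) (hlaw : ∀ t, μ.map (w t) = P)
    (hindep : iIndepFun w μ) :
    (∀ n : ℕ, 1 ≤ n →
      Integrable (fun ω => opmRegret f G x (fun t => w t ω) n) μ ∧
      ∫ ω, opmRegret f G x (fun t => w t ω) n ∂μ ≤ regretBound (meanWeight P) x n) ∧
    -- the bound is `O(L (1 / Δ) log n)`, where `Δ` is the smallest gap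
    (∀ Δ : ℝ,
      IsLeast {d | ∃ e i : Fin L, (i : WithBot (Fin L)) ≤ rho (meanWeight P) x e ∧
        d = gap (meanWeight P) e i} Δ →
      ∀ C : ℝ, 16 < C →
        ∀ᶠ n : ℕ in atTop,
          regretBound (meanWeight P) x n ≤ C * (L * (1 / Δ) * Real.log n)) := by
  have hxb : IsBase f x := by
    obtain ⟨⟨u, -, rfl⟩, -⟩ := hx
    exact isBase_greedyAlong hf _
  exact ⟨fun n _ => integral_opmRegret_le G hf hP hord hw hlaw hindep hxb n,
    fun Δ hΔ C hC => eventually_regretBound_le hord hΔ hC⟩
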